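/- All groups are finite. A \emph{stem extension} of a group $G$ is a surjective homomorphism $\pi:E\to G$ with $\ker\pi\subseteq Z(E)\cap[E,E]$; a \emph{Schur cover} of $G$ is a stem extension of $G$ with $|E|$ as large as possible. Given a Schur cover $\pi:\tilde G\to G$, the \emph{deep commuting graph} $\Delta_D(G)$ is the simple graph with vertex set $G$ in which two distinct elements are adjacent if and only if their preimages under $\pi$ commute in $\tilde G$. For a graph $\Gamma$, the \emph{reduced graph} $\Gamma^*$ is the subgraph induced on the set of vertices that are not dominant, a vertex being dominant if it is adjacent to all other vertices. (1) Let $p$ be a prime and let $G$ be a finite non-cyclic abelian $p$-group. Then $G$ has a Schur cover, and $G\cong C_{p^{r_1}}\times\cdots\times C_{p^{r_k}}$ for some $k\ge 2$ and $r_1\ge r_2\ge\cdots\ge r_k\ge 1$. For every such decomposition and every choice of the Schur cover, $\Delta_D(G)^*$ is disconnected if and only if $r_2=1$. (2) Let $A$ be a finite non-cyclic abelian group. Then $A$ has a Schur cover, and for every choice of the Schur cover, $\Delta_D(A)^*$ is disconnected if and only if $A\cong C\times K$, where $C$ is a cyclic group and $K$ is an elementary abelian $p$-group for some prime $p$ (an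 abelian group all of whose non-identity elements have order $p$). -/

import Mathlib

/-- A surjection `π : E → G` is a stem extension of `G` if its kernel lies in `Z(E) ∩ E'`. -/
structure IsStemExtension {E G : Type*} [Group E] [Group G] (π : E →* G) : Prop where
  surjective : Function.Surjective π
  ker_le : π.ker ≤ Subgroup.center E ⊓ commutator E

/-- A Schur cover of `G` is a finite stem extension `π : E → G` of maximal order. The competing
finite stem extensions may be taken in `Type`, since every finite group is isomorphic to one
there. -/
structure IsSchurCover {E G : Type*} [Group E] [Group G] (π : E →* G) : Prop where
  finite : Finite E
  isStemExtension : IsStemExtension π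
  card_le : ∀ (H : Type) [Group H] [Finite H] (ρ : H →* G), IsStemExtension ρ →
    Nat.card H ≤ Nat.card E

/-- The deep commuting graph of `G`, computed in a Schur cover `π : E → G`: distinct elements of
`G` are adjacent when their preimages commute in `E`. -/
def deepCommutingGraph {E G : Type*} [Group E] [Group G] (π : E →* G) : SimpleGraph G where
  Adj x y := x ≠ y ∧ ∀ a b : E, π a = x → π b = y → Commute a b
  symm := ⟨fun _ _ h => ⟨h.1.symm, fun a b ha hb => (h.2 b a hb ha).symm⟩⟩
  loopless := ⟨fun _ h => h.1 rfl⟩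

/-- The reduced graph `Γ*`: the subgraph induced on the vertices that are not dominant
(`Γ.universalVerts` is the set of vertices adjacent to all other vertices). -/
def reducedGraph {V : Type*} (Γ : SimpleGraph V) : SimpleGraph ↥(Γ.universalVertsᶜ) :=
  Γ.induce Γ.universalVertsᶜ

/-- `G ≅ C_{p^{r₁}} × ⋯ × C_{p^{r_k}}` with `r₁ ≥ ⋯ ≥ r_k ≥ 1`. (Indices start at `0` in `Fin k`,
so `r₁` is `r 0` and `r₂` is `r 1`.) -/
structure HasPType (p : ℕ) (G : Type*) [Group G] {k : ℕ} (r : Fin k → ℕ) : Prop where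
  antitone : Antitone r
  pos : ∀ i, 1 ≤ r i
  iso : Nonempty (G ≃* ((i : Fin k) → Multiplicative (ZMod (p ^ r i))))

/-- An elementary abelian `p`-group: abelian, with all non-identity elements of order `p`. -/
def IsElementaryAbelian (p : ℕ) (K : Type*) [CommGroup K] : Prop :=
  ∀ x : K, x ≠ 1 → orderOf x = p

/-!
Let `π : E → A` be a Schur cover of an abelian group. Characters `f, g : E → ℤ/n` define a central
extension of `E` by `ℤ/n` with cocycle `f(a) g(b)`, in which the commutator of lifts of `a` and `b`
is `⁅a, b⁆` together with `f(a) g(b) - f(b) g(a)`. If this minor is a unit, dividing out the cyclic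
group generated by the lift of a power of `⁅a, b⁆` leaves a stem extension of `A`, and the
maximality of `|E|` forces `n` to divide the order of `⁅a, b⁆`. Thus commutation in a Schur cover
is detected by characters of `A`.

If a prime `p` kills `E / Z(E)`, this makes commutation transitive outside the centre, so that the
reduced graph is not connected. If no prime does, choose `g` of maximal order modulo the centre:
every non-central `a` has a non-central power `aᵐ` with `aᵐᵖ` central for a prime `p`, and
`a - aᵐ - gᵖ - g` is a path, because `⁅aᵐ, gᵖ⁆ = ⁅aᵐᵖ, g⁆ = 1`.

Finally `m` kills `E / Z(E)` exactly when `m` is divisible by the greatest common divisors of the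
orders of any two cyclic factors of `A`, equivalently when `Aᵐ` is cyclic.
-/

open scoped commutatorElement

section CentralExtension

variable {E G : Type*} [Group E] [Group G] {π : E →* G}

/-- A central extension of `G`: a surjection onto `G` whose kernel is central. Compared with
`IsStemExtension`, the kernel need not lie in the commutator subgroup. -/
structure IsCentralExtension (π : E →* G) : Prop where
  surjective : Function.Surjective π
  ker_le_center : π.ker ≤ Subgroup.center E

theorem IsStemExtension.isCentralExtension (h : IsStemExtension π) : IsCentralExtension π :=
  ⟨h.surjective, h.ker_le.trans inf_le_left⟩

theorem IsStemExtension.id (G : Type*) [Group G] : IsStemExtension (MonoidHom.id G) :=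
  ⟨Function.surjective_id, by simp [MonoidHom.ker_id]⟩

theorem map_commutator_of_surjective {f : E →* G} (hf : Function.Surjective f) :
    (commutator E).map f = commutator G := by
  rw [map_commutator_eq, MonoidHom.range_eq_top.2 hf, commutator_def]

theorem IsStemExtension.comp_mulEquiv {F : Type*} [Group F] (h : IsStemExtension π)
    (e : F ≃* E) : IsStemExtension (π.comp e.toMonoidHom) where
  surjective := h.surjective.comp e.surjective
  ker_le x hx := by
    obtain ⟨hcenter, hcomm⟩ := h.ker_le (show e x ∈ π.ker from hx)
    refine ⟨Subgroup.mem_center_iff.2 fun y => e.injective ?_, ?_⟩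
    · simpa using Subgroup.mem_center_iff.1 hcenter (e y)
    · rw [← map_commutator_of_surjective (f := e.toMonoidHom) e.surjective] at hcomm
      obtain ⟨y, hy, hyx⟩ := hcomm
      rwa [← e.injective hyx]

theorem IsCentralExtension.exists_mem_center_mul_eq (h : IsCentralExtension π) {a a' : E}
    (ha : π a = π a') : ∃ z ∈ Subgroup.center E, a' * z = a :=
  ⟨a'⁻¹ * a, h.ker_le_center (by simp [MonoidHom.mem_ker, ha]), mul_inv_cancel_left a' a⟩

theorem IsCentralExtension.commutatorElement_congr_left (h : IsCentralExtension π) {a a' : E}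
    (ha : π a = π a') (b : E) : ⁅a, b⁆ = ⁅a', b⁆ := by
  obtain ⟨z, hz, rfl⟩ := h.exists_mem_center_mul_eq ha
  rw [commutatorElement_mul_left_eq_conj_mul,
    commutatorElement_eq_one_iff_mul_comm.2 (Subgroup.mem_center_iff.1 hz b).symm]
  simp

theorem IsCentralExtension.commutatorElement_congr (h : IsCentralExtension π) {a a' b b' : E}
    (ha : π a = π a') (hb : π b = π b') : ⁅a, b⁆ = ⁅a', b'⁆ := by
  rw [h.commutatorElement_congr_left ha, ← inv_inj, commutatorElement_inv,
    h.commutatorElement_congr_left hb, commutatorElement_inv]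

theorem IsCentralExtension.commute_congr (h : IsCentralExtension π) {a a' b b' : E}
    (ha : π a = π a') (hb : π b = π b') : Commute a b ↔ Commute a' b' := by
  simp only [← commutatorElement_eq_one_iff_commute, h.commutatorElement_congr ha hb]

theorem IsCentralExtension.commute_of_map_eq (h : IsCentralExtension π) {a b : E}
    (hab : π a = π b) : Commute a b :=
  (h.commute_congr hab rfl).2 (Commute.refl b)

theorem IsCentralExtension.card_commutatorSet_le [Finite G] (h : IsCentralExtension π) :
    Nat.card (commutatorSet E) ≤ Nat.card G * Nat.card G := by
  let s := Function.surjInv h.surjective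
  rw [← Nat.card_prod]
  refine Nat.card_le_card_of_surjective
    (fun x : G × G => (⟨⁅s x.1, s x.2⁆, s x.1, s x.2, rfl⟩ : commutatorSet E)) ?_
  rintro ⟨_, a, b, rfl⟩
  exact ⟨(π a, π b), Subtype.ext <|
    h.commutatorElement_congr (Function.surjInv_eq _ _) (Function.surjInv_eq _ _)⟩

theorem normal_of_le_center {N : Subgroup E} (hN : N ≤ Subgroup.center E) : N.Normal :=
  ⟨fun x hx y => by rwa [Subgroup.mem_center_iff.1 (hN hx) y, mul_inv_cancel_right]⟩

theorem card_eq_card_ker_mul_card (hπ : Function.Surjective π) :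
    Nat.card E = Nat.card π.ker * Nat.card G := by
  rw [← Subgroup.card_mul_index π.ker, Subgroup.index_ker, MonoidHom.range_eq_top.2 hπ,
    Subgroup.card_top]

theorem IsCentralExtension.index_center_le [Finite G] (h : IsCentralExtension π) :
    (Subgroup.center E).index ≤ Nat.card G := by
  have hindex : π.ker.index = Nat.card G := by
    rw [Subgroup.index_ker, MonoidHom.range_eq_top.2 h.surjective, Subgroup.card_top]
  rw [← hindex]
  exact Subgroup.index_antitone h.ker_le_center

theorem IsCentralExtension.card_commutator_le [Finite E] (h : IsCentralExtension π) :
    Nat.card (commutator E) ≤ Nat.card G ^ (Nat.card G * (Nat.card G * Nat.card G) + 1) := by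
  have : Finite G := .of_surjective π h.surjective
  calc Nat.card (commutator E)
      ≤ (Subgroup.center E).index ^
          ((Subgroup.center E).index * Nat.card (commutatorSet E) + 1) :=
        Nat.le_of_dvd (pow_pos (Nat.pos_of_ne_zero Subgroup.index_ne_zero_of_finite) _)
          (Subgroup.card_commutator_dvd_index_center_pow E)
    _ ≤ Nat.card G ^ (Nat.card G * (Nat.card G * Nat.card G) + 1) := by
        gcongr
        exacts [Nat.card_pos, h.index_center_le, h.index_center_le, h.card_commutatorSet_le]

theorem IsStemExtension.card_le [Finite E] (h : IsStemExtension π) :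
    Nat.card E ≤ Nat.card G ^ (Nat.card G * (Nat.card G * Nat.card G) + 1) * Nat.card G := by
  rw [card_eq_card_ker_mul_card h.surjective]
  gcongr
  exact (Nat.card_le_card_of_injective _ (Subgroup.inclusion_injective
    (h.ker_le.trans inf_le_right))).trans h.isCentralExtension.card_commutator_le

theorem IsStemExtension.of_quotient {N : Subgroup E} [N.Normal] (h : IsCentralExtension π)
    (hN : N ≤ π.ker) (hker : π.ker ≤ commutator E ⊔ N) :
    IsStemExtension (QuotientGroup.lift N π hN) where
  surjective := QuotientGroup.lift_surjective_of_surjective N π h.surjective hN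
  ker_le := by
    rintro ⟨x⟩ (hx : π x = 1)
    refine ⟨Subgroup.mem_center_iff.2 ?_, ?_⟩
    · rintro ⟨y⟩
      exact congrArg (QuotientGroup.mk (s := N))
        (Subgroup.mem_center_iff.1 (h.ker_le_center hx) y)
    · have hmem := Subgroup.mem_map_of_mem (QuotientGroup.mk' N) (hker hx)
      rwa [Subgroup.map_sup, QuotientGroup.map_mk'_self, sup_bot_eq,
        map_commutator_of_surjective (QuotientGroup.mk'_surjective N)] at hmem

end CentralExtension

section SchurCover

variable {E G : Type*} [Group E] [Group G] {π : E →* G}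

theorem exists_isSchurCover (G : Type*) [Group G] [Finite G] :
    ∃ (E : Type) (_ : Group E) (π : E →* G), IsSchurCover π := by
  let orders : Set ℕ := {n | ∃ (E : Type) (_ : Group E) (_ : Finite E) (π : E →* G),
    IsStemExtension π ∧ Nat.card E = n}
  have hbdd : BddAbove orders := by
    refine ⟨Nat.card G ^ (Nat.card G * (Nat.card G * Nat.card G) + 1) * Nat.card G, ?_⟩
    rintro _ ⟨E, _, _, π, hπ, rfl⟩
    exact hπ.card_le
  have hne : orders.Nonempty := by
    obtain ⟨G', _, _, ⟨e⟩⟩ := Finite.exists_type_univ_nonempty_mulEquiv.{_, 0} G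
    exact ⟨_, G', _, inferInstance, _, (IsStemExtension.id G).comp_mulEquiv e.symm, rfl⟩
  obtain ⟨E, _, hfinite, π, hπ, hcard⟩ := Nat.sSup_mem hne hbdd
  exact ⟨E, _, π, hfinite, hπ, fun H _ _ ρ hρ =>
    hcard ▸ le_csSup hbdd ⟨H, _, inferInstance, ρ, hρ, rfl⟩⟩

theorem IsSchurCover.isCentralExtension (h : IsSchurCover π) : IsCentralExtension π :=
  h.isStemExtension.isCentralExtension

theorem IsSchurCover.card_le_of_isStemExtension (h : IsSchurCover π) {H : Type*} [Group H]
    [Finite H] {ρ : H →* G} (hρ : IsStemExtension ρ) : Nat.card H ≤ Nat.card E := by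
  obtain ⟨H', _, _, ⟨e⟩⟩ := Finite.exists_type_univ_nonempty_mulEquiv.{_, 0} H
  rw [Nat.card_congr e.toEquiv]
  exact h.card_le H' _ (hρ.comp_mulEquiv e.symm)

theorem IsSchurCover.card_le_card_mul_card (h : IsSchurCover π) {X : Type*} [Group X] [Finite X]
    {ρ : X →* G} (hρ : IsCentralExtension ρ) {N : Subgroup X} (hN : N ≤ ρ.ker)
    (hker : ρ.ker ≤ commutator X ⊔ N) : Nat.card X ≤ Nat.card E * Nat.card N := by
  have : N.Normal := normal_of_le_center (hN.trans hρ.ker_le_center)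
  rw [Subgroup.card_eq_card_quotient_mul_card_subgroup N]
  gcongr
  exact h.card_le_of_isStemExtension (IsStemExtension.of_quotient hρ hN hker)

end SchurCover

section BilinearExtension

variable {E M : Type*} [Group E] [CommGroup M] {β : E →* E →* M}

/-- The central extension of `E` by `M` with the bilinear cocycle `β`: the set `E × M` with
multiplication `(a, s) (b, t) = (a b, s t β(a, b))`. It realizes the alternating form
`β(a, b) / β(b, a)` by commutators. -/
@[ext]
structure BilinearExtension (β : E →* E →* M) where
  fst : E
  snd : M

namespace BilinearExtension

instance : Mul (BilinearExtension β) :=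
  ⟨fun x y => ⟨x.fst * y.fst, x.snd * y.snd * β x.fst y.fst⟩⟩

instance : One (BilinearExtension β) := ⟨⟨1, 1⟩⟩

instance : Inv (BilinearExtension β) := ⟨fun x => ⟨x.fst⁻¹, x.snd⁻¹ * β x.fst x.fst⟩⟩

@[simp]
theorem mk_mul_mk (a b : E) (s t : M) :
    (⟨a, s⟩ * ⟨b, t⟩ : BilinearExtension β) = ⟨a * b, s * t * β a b⟩ := rfl

@[simp]
theorem fst_mul (x y : BilinearExtension β) : (x * y).fst = x.fst * y.fst := rfl

@[simp]
theorem snd_mul (x y : BilinearExtension β) :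
    (x * y).snd = x.snd * y.snd * β x.fst y.fst := rfl

@[simp]
theorem fst_one : (1 : BilinearExtension β).fst = 1 := rfl

@[simp]
theorem snd_one : (1 : BilinearExtension β).snd = 1 := rfl

@[simp]
theorem fst_inv (x : BilinearExtension β) : x⁻¹.fst = x.fst⁻¹ := rfl

@[simp]
theorem snd_inv (x : BilinearExtension β) : x⁻¹.snd = x.snd⁻¹ * β x.fst x.fst := rfl

instance : Group (BilinearExtension β) := Group.ofLeftAxioms
  (fun x y z => by ext <;> simp [mul_assoc, mul_left_comm, mul_comm])
  (fun x => by ext <;> simp)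
  (fun x => by ext <;> simp [mul_right_comm])

/-- The projection of the bilinear extension onto its base. -/
def fstHom (β : E →* E →* M) : BilinearExtension β →* E where
  toFun := fst
  map_one' := rfl
  map_mul' _ _ := rfl

@[simp]
theorem fstHom_apply (x : BilinearExtension β) : fstHom β x = x.fst := rfl

theorem fstHom_surjective : Function.Surjective (fstHom β) := fun a => ⟨⟨a, 1⟩, rfl⟩

/-- The inclusion of the central subgroup `M` in the bilinear extension. -/
def inr (β : E →* E →* M) : M →* BilinearExtension β where
  toFun t := ⟨1, t⟩
  map_one' := rfl
  map_mul' _ _ := by ext <;> simp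

@[simp]
theorem inr_apply (t : M) : inr β t = ⟨1, t⟩ := rfl

/-- The underlying set of the bilinear extension is a product. -/
def equivProd (β : E →* E →* M) : BilinearExtension β ≃ E × M where
  toFun x := (x.fst, x.snd)
  invFun x := ⟨x.1, x.2⟩

instance [Finite E] [Finite M] : Finite (BilinearExtension β) :=
  .of_equiv _ (equivProd β).symm

theorem card_eq : Nat.card (BilinearExtension β) = Nat.card E * Nat.card M := by
  rw [Nat.card_congr (equivProd β), Nat.card_prod]

theorem mk_pow {c : E} (hc : β c = 1) (t : M) (n : ℕ) :
    (⟨c, t⟩ : BilinearExtension β) ^ n = ⟨c ^ n, t ^ n⟩ := by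
  induction n with
  | zero => simp only [pow_zero]; rfl
  | succ n ih => rw [pow_succ, ih]; simp [hc, pow_succ]

theorem orderOf_mk_one {c : E} (hc : β c = 1) :
    orderOf (⟨c, 1⟩ : BilinearExtension β) = orderOf c := by
  refine orderOf_eq_orderOf_iff.2 fun n => ?_
  simp [mk_pow hc, BilinearExtension.ext_iff]

theorem commutatorElement_mk_one (a b : E) :
    ⁅(⟨a, 1⟩ : BilinearExtension β), (⟨b, 1⟩ : BilinearExtension β)⁆ =
      (⟨⁅a, b⁆, β a b / β b a⟩ : BilinearExtension β) := by
  rw [commutatorElement_def, mul_inv_eq_iff_eq_mul, mul_inv_eq_iff_eq_mul]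
  simp [mul_assoc, commutatorElement_def]

theorem map_eq_one_of_mem_commutator (f : E →* M) {c : E} (hc : c ∈ commutator E) : f c = 1 :=
  Abelianization.commutator_subset_ker f hc

theorem mk_mem_center {c : E} (hc : c ∈ Subgroup.center E ⊓ commutator E) (t : M) :
    (⟨c, t⟩ : BilinearExtension β) ∈ Subgroup.center (BilinearExtension β) := by
  refine Subgroup.mem_center_iff.2 fun x => ?_
  ext
  · exact Subgroup.mem_center_iff.1 hc.1 x.fst
  · simp [map_eq_one_of_mem_commutator _ hc.2, mul_comm]

variable {G : Type*} [Group G] {π : E →* G}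

theorem isCentralExtension_comp_fstHom (hπ : IsStemExtension π) (β : E →* E →* M) :
    IsCentralExtension (π.comp (fstHom β)) where
  surjective := hπ.surjective.comp fstHom_surjective
  ker_le_center x hx := mk_mem_center (hπ.ker_le hx) x.snd

/-- Here `[X, X]` maps onto `[E, E] ≥ ker π`, so only the fibre `M` remains to be generated. -/
theorem ker_comp_fstHom_le_sup (hπ : IsStemExtension π) {N : Subgroup (BilinearExtension β)}
    (hN : (inr β).range ≤ commutator (BilinearExtension β) ⊔ N) :
    (π.comp (fstHom β)).ker ≤ commutator (BilinearExtension β) ⊔ N := by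
  rintro ⟨c, t⟩ hc
  have hcomm : c ∈ commutator E := (hπ.ker_le hc).2
  rw [← map_commutator_of_surjective (fstHom_surjective (β := β))] at hcomm
  obtain ⟨⟨c, s⟩, hs, rfl⟩ := hcomm
  have hfactor : (⟨c, t⟩ : BilinearExtension β) = ⟨c, s⟩ * inr β (s⁻¹ * t) := by simp
  rw [fstHom_apply, hfactor]
  exact mul_mem (Subgroup.mem_sup_left hs) (hN ⟨_, rfl⟩)

theorem range_inr_le_sup {c : E} {t : M} (ht : Subgroup.zpowers t = ⊤)
    (hct : (⟨c, t⟩ : BilinearExtension β) ∈ commutator (BilinearExtension β)) :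
    (inr β).range ≤ commutator (BilinearExtension β) ⊔ Subgroup.zpowers ⟨c, 1⟩ := by
  rw [MonoidHom.range_eq_map, ← ht, MonoidHom.map_zpowers, Subgroup.zpowers_le]
  have hfactor : inr β t = ⟨c, t⟩ * (⟨c, 1⟩ : BilinearExtension β)⁻¹ := by
    rw [eq_mul_inv_iff_mul_eq]
    simp
  rw [hfactor]
  exact mul_mem (Subgroup.mem_sup_left hct)
    (inv_mem (Subgroup.mem_sup_right (Subgroup.mem_zpowers _)))

end BilinearExtension

end BilinearExtension

section CommutatorOrder

variable {E G : Type*} [Group E] [Group G] {π : E →* G}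

theorem commutatorElement_mem_ker {a b : E} (hab : Commute (π a) (π b)) : ⁅a, b⁆ ∈ π.ker := by
  rwa [MonoidHom.mem_ker, map_commutatorElement, commutatorElement_eq_one_iff_commute]

open BilinearExtension in
/-- Dividing the bilinear extension by `⟨(c, 1)⟩` gives a stem extension, whose order maximality
bounds by `|E|`. -/
theorem IsSchurCover.card_le_orderOf (h : IsSchurCover π) {M : Type*} [CommGroup M] [Finite M]
    {β : E →* E →* M} {c : E} (hc : c ∈ π.ker) {t : M} (ht : Subgroup.zpowers t = ⊤)
    (hct : (⟨c, t⟩ : BilinearExtension β) ∈ commutator (BilinearExtension β)) :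
    Nat.card M ≤ orderOf c := by
  have := h.finite
  have hβc : β c = 1 := map_eq_one_of_mem_commutator β (h.isStemExtension.ker_le hc).2
  have hle := h.card_le_card_mul_card (isCentralExtension_comp_fstHom h.isStemExtension β)
    (N := Subgroup.zpowers ⟨c, 1⟩) (by simpa using hc)
    (ker_comp_fstHom_le_sup h.isStemExtension (range_inr_le_sup ht hct))
  rw [card_eq, Nat.card_zpowers, orderOf_mk_one hβc] at hle
  exact le_of_mul_le_mul_left hle Nat.card_pos

theorem IsSchurCover.prime_pow_dvd_orderOf_commutatorElement (h : IsSchurCover π) {M : Type*}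
    [CommGroup M] {q k : ℕ} (hq : q.Prime) (hM : Nat.card M = q ^ k) (β : E →* E →* M) {a b : E}
    (hab : Commute (π a) (π b)) (hgen : Subgroup.zpowers (β a b / β b a) = ⊤) :
    q ^ k ∣ orderOf ⁅a, b⁆ := by
  have := h.finite
  have : Finite M := Nat.finite_of_card_ne_zero (hM ▸ pow_ne_zero k hq.ne_zero)
  have hc : ⁅a, b⁆ ∈ π.ker := commutatorElement_mem_ker hab
  have hβc : β ⁅a, b⁆ = 1 :=
    BilinearExtension.map_eq_one_of_mem_commutator β (h.isStemExtension.ker_le hc).2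
  obtain ⟨s, m, hm, horder⟩ :=
    Nat.exists_eq_pow_mul_and_not_dvd (orderOf_pos ⁅a, b⁆).ne' q hq.ne_one
  have hm0 : m ≠ 0 := by rintro rfl; exact hm (dvd_zero q)
  have horder_pow : orderOf (⁅a, b⁆ ^ m) = q ^ s := by
    rw [orderOf_pow_of_dvd hm0 (horder ▸ Dvd.intro_left _ rfl), horder,
      Nat.mul_div_cancel _ (Nat.pos_of_ne_zero hm0)]
  have hgen_pow : Subgroup.zpowers ((β a b / β b a) ^ m) = ⊤ := by
    have hcoprime : m.gcd (orderOf (β a b / β b a)) = 1 := by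
      rw [orderOf_eq_card_of_zpowers_eq_top hgen, hM]
      exact ((hq.coprime_iff_not_dvd.2 hm).symm.pow_right k)
    rw [eq_top_iff, ← hgen, Subgroup.zpowers_le]
    exact mem_zpowers_pow_iff.2 hcoprime
  have hle : q ^ k ≤ q ^ s := by
    rw [← hM, ← horder_pow]
    refine h.card_le_orderOf (β := β) (pow_mem hc m) hgen_pow ?_
    rw [← BilinearExtension.mk_pow hβc, ← BilinearExtension.commutatorElement_mk_one]
    exact pow_mem (Subgroup.commutator_mem_commutator (Subgroup.mem_top _) (Subgroup.mem_top _)) m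
  rw [horder]
  exact (pow_dvd_pow q ((Nat.pow_le_pow_iff_right hq.one_lt).1 hle)).mul_right m

/-- The bilinear form `(a, b) ↦ f a * g b` with values in the additive group of a ring, built from
two characters. The group law is multiplicative, so `f`, `g` and the form take their values in
`Multiplicative R`. -/
def mulForm {R : Type*} [CommRing R] (f g : E →* Multiplicative R) :
    E →* E →* Multiplicative R :=
  MonoidHom.mk' (fun a => MonoidHom.mk' (fun b => .ofAdd ((f a).toAdd * (g b).toAdd))
    fun b b' => by simp [mul_add]) fun a a' => by ext b; simp [add_mul]

theorem zpowers_ofAdd_eq_top_of_isUnit {n : ℕ} {u : ZMod n} (hu : IsUnit u) :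
    Subgroup.zpowers (Multiplicative.ofAdd u) = ⊤ := by
  obtain ⟨v, hv⟩ := hu.exists_right_inv
  refine eq_top_iff.2 fun x _ => ?_
  obtain ⟨m, hm⟩ := ZMod.intCast_surjective (v * x.toAdd)
  refine ⟨m, Multiplicative.toAdd.injective ?_⟩
  change (m • u : ZMod n) = x.toAdd
  rw [zsmul_eq_mul, hm, mul_right_comm, mul_comm v u, hv, one_mul]

theorem IsSchurCover.dvd_orderOf_commutatorElement (h : IsSchurCover π) {n : ℕ}
    (f g : E →* Multiplicative (ZMod n)) {a b : E} (hab : Commute (π a) (π b))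
    (hdet : IsUnit ((f a).toAdd * (g b).toAdd - (f b).toAdd * (g a).toAdd)) :
    n ∣ orderOf ⁅a, b⁆ := by
  refine (Nat.dvd_iff_prime_pow_dvd_dvd _ _).2 fun q k hq hqk => ?_
  let ρ := ZMod.castHom hqk (ZMod (q ^ k))
  let ρ' := AddMonoidHom.toMultiplicative ρ.toAddMonoidHom
  have hgen := zpowers_ofAdd_eq_top_of_isUnit (hdet.map ρ)
  rw [map_sub, map_mul, map_mul] at hgen
  exact h.prime_pow_dvd_orderOf_commutatorElement (M := Multiplicative (ZMod (q ^ k))) hq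
    (Nat.card_zmod _) (mulForm (ρ'.comp f) (ρ'.comp g)) hab hgen

end CommutatorOrder

section Commutators

variable {E : Type*} [Group E]

theorem commutatorElement_pow_left {a b : E} (h : Commute a ⁅a, b⁆) (n : ℕ) :
    ⁅a ^ n, b⁆ = ⁅a, b⁆ ^ n := by
  induction n with
  | zero => simp
  | succ n ih =>
    rw [pow_succ, commutatorElement_mul_left_eq_conj_mul, ih, (h.pow_left n).eq,
      mul_inv_cancel_right, pow_succ']

theorem commutatorElement_pow_right {a b : E} (h : Commute b ⁅a, b⁆) (n : ℕ) :
    ⁅a, b ^ n⁆ = ⁅a, b⁆ ^ n := by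
  rw [← commutatorElement_inv b, ← commutatorElement_inv (b ^ n),
    commutatorElement_pow_left (by rwa [← commutatorElement_inv, Commute.inv_right_iff]), inv_pow]

theorem commute_pow_left_iff_commute_pow_right {a b : E} (h : ⁅a, b⁆ ∈ Subgroup.center E) (n : ℕ) :
    Commute (a ^ n) b ↔ Commute a (b ^ n) := by
  rw [← commutatorElement_eq_one_iff_commute, ← commutatorElement_eq_one_iff_commute,
    commutatorElement_pow_left (Subgroup.mem_center_iff.1 h a),
    commutatorElement_pow_right (Subgroup.mem_center_iff.1 h b)]

theorem orderOf_commutatorElement_dvd {a b : E} (h : Commute a ⁅a, b⁆) {n : ℕ}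
    (hab : Commute (a ^ n) b) : orderOf ⁅a, b⁆ ∣ n := by
  rw [orderOf_dvd_iff_pow_eq_one, ← commutatorElement_pow_left h,
    commutatorElement_eq_one_iff_commute.2 hab]

variable {A : Type*} [CommGroup A] {π : E →* A}

theorem IsCentralExtension.commutatorElement_mem_center (h : IsCentralExtension π) (a b : E) :
    ⁅a, b⁆ ∈ Subgroup.center E :=
  h.ker_le_center (commutatorElement_mem_ker (Commute.all _ _))

end Commutators

section CentralQuotient

theorem exists_forall_pow_eq_one (Q : Type*) [CommGroup Q] [Finite Q] :
    ∃ g : Q, ∀ n : ℕ, g ^ n = 1 → ∀ x : Q, x ^ n = 1 := by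
  obtain ⟨g, hg⟩ := Monoid.exists_orderOf_eq_exponent (Monoid.ExponentExists.of_finite (G := Q))
  exact ⟨g, fun n hn x => orderOf_dvd_iff_pow_eq_one.1
    ((Monoid.order_dvd_exponent x).trans (hg ▸ orderOf_dvd_of_pow_eq_one hn))⟩

variable {E A : Type*} [Group E] [CommGroup A] {π : E →* A}

theorem IsCentralExtension.exists_forall_pow_mem_center [Finite E] (h : IsCentralExtension π) :
    ∃ g : E, ∀ n : ℕ, g ^ n ∈ Subgroup.center E → ∀ a : E, a ^ n ∈ Subgroup.center E := by
  have hcomm : ∀ x y : E ⧸ Subgroup.center E, x * y = y * x := by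
    rintro ⟨a⟩ ⟨b⟩
    refine (commutatorElement_eq_one_iff_mul_comm (g₁ := (a : E ⧸ Subgroup.center E))).1 ?_
    exact (QuotientGroup.eq_one_iff ⁅a, b⁆).2 (h.commutatorElement_mem_center a b)
  let _ : CommGroup (E ⧸ Subgroup.center E) := { mul_comm := hcomm }
  obtain ⟨⟨g⟩, hg⟩ := exists_forall_pow_eq_one (E ⧸ Subgroup.center E)
  exact ⟨g, fun n hn a => (QuotientGroup.eq_one_iff _).1
    (hg n ((QuotientGroup.eq_one_iff _).2 hn) (a : E ⧸ Subgroup.center E))⟩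

theorem exists_prime_pow_mem_of_notMem [Finite E] {N : Subgroup E} [N.Normal] {a : E}
    (ha : a ∉ N) : ∃ m p : ℕ, p.Prime ∧ a ^ m ∉ N ∧ (a ^ m) ^ p ∈ N := by
  have hne : (a : E ⧸ N) ≠ 1 := fun h => ha ((QuotientGroup.eq_one_iff a).1 h)
  have hprime : (orderOf (a : E ⧸ N)).minFac.Prime :=
    Nat.minFac_prime (mt orderOf_eq_one_iff.1 hne)
  refine ⟨orderOf (a : E ⧸ N) / (orderOf (a : E ⧸ N)).minFac, _, hprime, ?_⟩
  have horder := orderOf_pow_orderOf_div (orderOf_pos (a : E ⧸ N)).ne' (Nat.minFac_dvd _)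
  rw [← QuotientGroup.eq_one_iff, ← QuotientGroup.eq_one_iff, QuotientGroup.mk_pow,
    QuotientGroup.mk_pow, ← orderOf_eq_one_iff, QuotientGroup.mk_pow, horder]
  refine ⟨hprime.ne_one, ?_⟩
  nth_rw 2 [← horder]
  exact pow_orderOf_eq_one _

end CentralQuotient

section Graph

variable {E G : Type*} [Group E] [Group G] {π : E →* G}

theorem IsCentralExtension.deepCommutingGraph_adj (h : IsCentralExtension π) {a b : E} :
    (deepCommutingGraph π).Adj (π a) (π b) ↔ π a ≠ π b ∧ Commute a b :=
  and_congr_right fun _ =>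
    ⟨fun hcomm => hcomm a b rfl rfl, fun hab _ _ hc hd => (h.commute_congr hc hd).2 hab⟩

theorem IsCentralExtension.mem_universalVerts_deepCommutingGraph (h : IsCentralExtension π)
    {a : E} : π a ∈ (deepCommutingGraph π).universalVerts ↔ a ∈ Subgroup.center E := by
  rw [Subgroup.mem_center_iff]
  constructor
  · intro hdom b
    by_cases hab : π a = π b
    · exact (h.commute_of_map_eq hab).symm
    · exact (h.deepCommutingGraph_adj.1 (hdom hab)).2.symm
  · intro hcomm y hy
    obtain ⟨b, rfl⟩ := h.surjective y
    exact h.deepCommutingGraph_adj.2 ⟨hy, (hcomm b).symm⟩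

/-- The vertex of the reduced graph lying below a non-central element of the extension. -/
def IsCentralExtension.vertex (h : IsCentralExtension π) (a : E) (ha : a ∉ Subgroup.center E) :
    ↥((deepCommutingGraph π).universalVertsᶜ) :=
  ⟨π a, mt h.mem_universalVerts_deepCommutingGraph.1 ha⟩

theorem IsCentralExtension.exists_vertex_eq (h : IsCentralExtension π)
    (x : ↥((deepCommutingGraph π).universalVertsᶜ)) : ∃ a ha, h.vertex a ha = x := by
  obtain ⟨x, hx⟩ := x
  obtain ⟨a, rfl⟩ := h.surjective x
  exact ⟨a, mt h.mem_universalVerts_deepCommutingGraph.2 hx, rfl⟩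

theorem IsCentralExtension.reachable_of_commute (h : IsCentralExtension π) {a b : E}
    (ha : a ∉ Subgroup.center E) (hb : b ∉ Subgroup.center E) (hab : Commute a b) :
    (reducedGraph (deepCommutingGraph π)).Reachable (h.vertex a ha) (h.vertex b hb) := by
  by_cases hπ : π a = π b
  · rw [show h.vertex a ha = h.vertex b hb from Subtype.ext hπ]
  · exact SimpleGraph.Adj.reachable (h.deepCommutingGraph_adj.2 ⟨hπ, hab⟩)

theorem IsCentralExtension.commute_of_reachable (h : IsCentralExtension π)
    (htrans : ∀ a b c : E, b ∉ Subgroup.center E → Commute a b → Commute b c → Commute a c)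
    {a b : E} {ha : a ∉ Subgroup.center E} {hb : b ∉ Subgroup.center E}
    (hab : (reducedGraph (deepCommutingGraph π)).Reachable (h.vertex a ha) (h.vertex b hb)) :
    Commute a b := by
  rw [SimpleGraph.reachable_iff_reflTransGen] at hab
  generalize hx : h.vertex b hb = x at hab
  induction hab generalizing b with
  | refl => exact (h.commute_of_map_eq (congrArg Subtype.val hx)).symm
  | @tail y _ _ hadj ih =>
    obtain ⟨c, hc, rfl⟩ := h.exists_vertex_eq y
    subst hx
    exact htrans a c b hc (ih rfl) (h.deepCommutingGraph_adj.1 hadj).2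

theorem IsCentralExtension.not_connected_reducedGraph (h : IsCentralExtension π)
    (htrans : ∀ a b c : E, b ∉ Subgroup.center E → Commute a b → Commute b c → Commute a c) :
    ¬ (reducedGraph (deepCommutingGraph π)).Connected := by
  intro hconn
  obtain ⟨x⟩ := hconn.nonempty
  obtain ⟨a, ha, rfl⟩ := h.exists_vertex_eq x
  refine ha (Subgroup.mem_center_iff.2 fun b => ?_)
  by_cases hb : b ∈ Subgroup.center E
  · exact (Subgroup.mem_center_iff.1 hb a).symm
  · exact h.commute_of_reachable htrans (hconn.preconnected (h.vertex b hb) (h.vertex a ha))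

theorem IsCentralExtension.connected_reducedGraph {A : Type*} [CommGroup A] {π : E →* A}
    [Finite E] (h : IsCentralExtension π)
    (hp : ∀ p : ℕ, p.Prime → ∃ a : E, a ^ p ∉ Subgroup.center E) :
    (reducedGraph (deepCommutingGraph π)).Connected := by
  obtain ⟨g, hg⟩ := h.exists_forall_pow_mem_center
  have hgp : ∀ p : ℕ, p.Prime → g ^ p ∉ Subgroup.center E := fun p hprime hmem =>
    (hp p hprime).elim fun a ha => ha (hg p hmem a)
  have hg1 : g ∉ Subgroup.center E := fun hmem => hgp 2 Nat.prime_two (pow_mem hmem 2)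
  rw [SimpleGraph.connected_iff_exists_forall_reachable]
  refine ⟨h.vertex g hg1, fun x => ?_⟩
  obtain ⟨a, ha, rfl⟩ := h.exists_vertex_eq x
  obtain ⟨m, p, hprime, ham, hamp⟩ := exists_prime_pow_mem_of_notMem ha
  have hcomm : Commute (a ^ m) (g ^ p) :=
    (commute_pow_left_iff_commute_pow_right (h.commutatorElement_mem_center _ _) p).1
      (Subgroup.mem_center_iff.1 hamp g).symm
  exact (h.reachable_of_commute hg1 (hgp p hprime) (Commute.self_pow g p)).trans <|
    (h.reachable_of_commute (hgp p hprime) ham hcomm.symm).trans <|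
      h.reachable_of_commute ham ha (Commute.pow_self a m)

end Graph

section PrimeExponent

theorem exists_addMonoidHom_zmod_ne_zero {p : ℕ} [Fact p.Prime] {V : Type*} [AddCommGroup V]
    (hV : ∀ v : V, p • v = 0) {x : V} (hx : x ≠ 0) : ∃ f : V →+ ZMod p, f x ≠ 0 := by
  have := AddCommGroup.zmodModule hV
  by_contra! hzero
  exact hx ((Module.forall_dual_apply_eq_zero_iff (ZMod p) x).1 fun f => hzero f.toAddMonoidHom)

theorem exists_monoidHom_zmod_ne_one {A : Type*} [CommGroup A] {p : ℕ} [Fact p.Prime] {x : A}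
    (hx : x ∉ (powMonoidHom p : A →* A).range) : ∃ f : A →* Multiplicative (ZMod p), f x ≠ 1 := by
  let mk := QuotientGroup.mk' (powMonoidHom p : A →* A).range
  have hmk : Additive.ofMul (mk x) ≠ 0 := mt (QuotientGroup.eq_one_iff x).1 hx
  obtain ⟨f, hf⟩ := exists_addMonoidHom_zmod_ne_zero (p := p) (fun v => by
    obtain ⟨y, hy⟩ := QuotientGroup.mk'_surjective _ v.toMul
    rw [← ofMul_toMul v, ← ofMul_pow, ← hy, ← map_pow]
    exact (QuotientGroup.eq_one_iff _).2 ⟨y, rfl⟩) hmk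
  exact ⟨(AddMonoidHom.toMultiplicativeRight f).comp mk, hf⟩

variable {E A : Type*} [Group E] [CommGroup A] {π : E →* A}

theorem IsCentralExtension.mem_center_of_map_mem_range_pow (h : IsCentralExtension π) {m : ℕ}
    (hm : ∀ a : E, a ^ m ∈ Subgroup.center E) {b : E}
    (hb : π b ∈ (powMonoidHom m : A →* A).range) : b ∈ Subgroup.center E := by
  obtain ⟨x, hx⟩ := hb
  obtain ⟨a, rfl⟩ := h.surjective x
  obtain ⟨z, hz, rfl⟩ := h.exists_mem_center_mul_eq (a := b) (a' := a ^ m)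
    (by rw [map_pow, ← hx, powMonoidHom_apply])
  exact mul_mem (hm a) hz

/-- The characters of `A` of order `p` see `π a` and `π b` as proportional vectors: a nonzero
`2 × 2` minor would force `p` to divide the order of `⁅a, b⁆ = 1`. -/
theorem IsSchurCover.exists_map_mul_pow_inv_mem_range_pow (h : IsSchurCover π) {p : ℕ}
    (hp : p.Prime) {a b : E} (hab : Commute a b) (hb : π b ∉ (powMonoidHom p : A →* A).range) :
    ∃ m : ℕ, π (a * (b ^ m)⁻¹) ∈ (powMonoidHom p : A →* A).range := by
  have : Fact p.Prime := ⟨hp⟩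
  have hminor : ∀ f g : A →* Multiplicative (ZMod p),
      (f (π a)).toAdd * (g (π b)).toAdd = (f (π b)).toAdd * (g (π a)).toAdd := by
    intro f g
    by_contra hne
    have hdvd := h.dvd_orderOf_commutatorElement (f.comp π) (g.comp π) (hab.map π)
      (sub_ne_zero.2 hne).isUnit
    rw [commutatorElement_eq_one_iff_commute.2 hab, orderOf_one] at hdvd
    exact hp.not_dvd_one hdvd
  obtain ⟨f, hf⟩ := exists_monoidHom_zmod_ne_one hb
  have hfb : (f (π b)).toAdd ≠ 0 := hf
  let m : ℕ := ((f (π a)).toAdd * (f (π b)).toAdd⁻¹).val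
  have hm : (m : ZMod p) = (f (π a)).toAdd * (f (π b)).toAdd⁻¹ := ZMod.natCast_zmod_val _
  refine ⟨m, by_contra fun hmem => ?_⟩
  obtain ⟨g, hg⟩ := exists_monoidHom_zmod_ne_one hmem
  refine hg (Multiplicative.toAdd.injective ?_)
  simp only [map_mul, map_inv, map_pow, toAdd_mul, toAdd_inv, toAdd_pow, nsmul_eq_mul, toAdd_one,
    hm]
  field_simp
  linear_combination -hminor f g

theorem IsSchurCover.commute_trans (h : IsSchurCover π) {p : ℕ} (hp : p.Prime)
    (hcenter : ∀ a : E, a ^ p ∈ Subgroup.center E) (a b c : E) (hb : b ∉ Subgroup.center E)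
    (hab : Commute a b) (hbc : Commute b c) : Commute a c := by
  have hmem : ∀ {x : E}, π x ∈ (powMonoidHom p : A →* A).range → x ∈ Subgroup.center E :=
    h.isCentralExtension.mem_center_of_map_mem_range_pow hcenter
  obtain ⟨m, hm⟩ := h.exists_map_mul_pow_inv_mem_range_pow hp hab (mt hmem hb)
  have hac : Commute (a * (b ^ m)⁻¹) c := (Subgroup.mem_center_iff.1 (hmem hm) c).symm
  simpa using hac.mul_left (hbc.pow_left m)

theorem IsSchurCover.not_connected_iff_exists_prime (h : IsSchurCover π) :
    ¬ (reducedGraph (deepCommutingGraph π)).Connected ↔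
      ∃ p : ℕ, p.Prime ∧ ∀ a : E, a ^ p ∈ Subgroup.center E := by
  have := h.finite
  constructor
  · contrapose!
    exact h.isCentralExtension.connected_reducedGraph
  · rintro ⟨p, hp, hcenter⟩
    exact h.isCentralExtension.not_connected_reducedGraph (h.commute_trans hp hcenter)

end PrimeExponent

section PowerSubgroup

theorem isCyclic_range_pow_iff {A : Type*} [CommGroup A] {m : ℕ} :
    IsCyclic (powMonoidHom m : A →* A).range ↔
      ∃ g : A, ∀ x : A, x ^ m ∈ Subgroup.zpowers (g ^ m) := by
  rw [Subgroup.isCyclic_iff_exists_zpowers_eq_top]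
  constructor
  · rintro ⟨y, hy⟩
    obtain ⟨g, rfl⟩ : y ∈ (powMonoidHom m : A →* A).range := hy ▸ Subgroup.mem_zpowers y
    exact ⟨g, fun x => hy.ge ⟨x, rfl⟩⟩
  · rintro ⟨g, hg⟩
    refine ⟨g ^ m, le_antisymm (Subgroup.zpowers_le.2 ⟨g, rfl⟩) ?_⟩
    rintro _ ⟨x, rfl⟩
    exact hg x

theorem isCyclic_range_pow_of_mulEquiv {A B : Type*} [CommGroup A] [CommGroup B] {m : ℕ}
    (φ : A ≃* B) (hB : IsCyclic (powMonoidHom m : B →* B).range) :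
    IsCyclic (powMonoidHom m : A →* A).range := by
  rw [isCyclic_range_pow_iff] at hB ⊢
  obtain ⟨g, hg⟩ := hB
  refine ⟨φ.symm g, fun x => ?_⟩
  obtain ⟨k, hk⟩ := hg (φ x)
  exact ⟨k, φ.injective (by simpa using hk)⟩

theorem coprime_div_gcd_of_gcd_dvd {a b m : ℕ} (ha : a ≠ 0) (hm : a.gcd b ∣ m) :
    (a / a.gcd m).Coprime (b / b.gcd m) := by
  have hpos : 0 < a.gcd b := Nat.gcd_pos_of_pos_left b (Nat.pos_of_ne_zero ha)
  exact (Nat.coprime_div_gcd_div_gcd hpos).of_dvd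
    (Nat.div_dvd_div_left (Nat.gcd_dvd_left _ _) (Nat.dvd_gcd (Nat.gcd_dvd_left _ _) hm))
    (Nat.div_dvd_div_left (Nat.gcd_dvd_left _ _) (Nat.dvd_gcd (Nat.gcd_dvd_right _ _) hm))

theorem exists_forall_mul_modEq {ι : Type*} [Finite ι] {n : ι → ℕ} [∀ i, NeZero (n i)] {m : ℕ}
    (hm : Pairwise fun i j => (n i).gcd (n j) ∣ m) (x : ι → ℕ) :
    ∃ k : ℕ, ∀ i, m * k ≡ m * x i [MOD n i] := by
  classical
  cases nonempty_fintype ι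
  obtain ⟨k, hk⟩ := Nat.chineseRemainderOfFinset x (fun i => n i / (n i).gcd m) Finset.univ
    (fun i _ => (Nat.div_gcd_pos_of_pos_left m (NeZero.pos (n i))).ne')
    fun i _ j _ hij => coprime_div_gcd_of_gcd_dvd (NeZero.ne (n i)) (hm hij)
  refine ⟨k, fun i => ((hk i (Finset.mem_univ i)).mul_left' m).of_dvd ?_⟩
  rw [← Nat.mul_div_assoc m (Nat.gcd_dvd_left _ _), Nat.mul_comm,
    Nat.mul_div_assoc _ (Nat.gcd_dvd_right _ _)]
  exact Dvd.intro _ rfl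

theorem isCyclic_range_pow_pi_zmod {ι : Type*} [Finite ι] {n : ι → ℕ} [∀ i, NeZero (n i)] {m : ℕ}
    (hm : Pairwise fun i j => (n i).gcd (n j) ∣ m) :
    IsCyclic (powMonoidHom m : ((i : ι) → Multiplicative (ZMod (n i))) →* _).range := by
  refine isCyclic_range_pow_iff.2 ⟨fun i => .ofAdd 1, fun x => ?_⟩
  obtain ⟨k, hk⟩ := exists_forall_mul_modEq hm fun i => (x i).toAdd.val
  refine ⟨k, funext fun i => Multiplicative.toAdd.injective ?_⟩
  have hki := (ZMod.natCast_eq_natCast_iff _ _ _).2 (hk i)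
  simpa [mul_comm] using hki

end PowerSubgroup

section CentralExponent

variable {E A : Type*} [Group E] [CommGroup A] {π : E →* A}

theorem IsCentralExtension.pow_mem_center_of_isCyclic_range_pow (h : IsCentralExtension π) {m : ℕ}
    (hm : IsCyclic (powMonoidHom m : A →* A).range) (a : E) : a ^ m ∈ Subgroup.center E := by
  obtain ⟨g, hg⟩ := isCyclic_range_pow_iff.1 hm
  obtain ⟨c, rfl⟩ := h.surjective g
  have hpow : ∀ b : E, ∃ k : ℤ, π (b ^ m) = π ((c ^ k) ^ m) := fun b => by
    obtain ⟨k, hk⟩ := hg (π b)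
    refine ⟨k, ?_⟩
    rw [map_pow, ← hk, map_pow, map_zpow]
    simpa only [zpow_natCast] using zpow_comm (π c) m k
  refine Subgroup.mem_center_iff.2 fun b => ?_
  obtain ⟨k, hk⟩ := hpow a
  obtain ⟨l, hl⟩ := hpow b
  refine ((h.commute_congr hk rfl).2 ?_).symm
  rw [commute_pow_left_iff_commute_pow_right (h.commutatorElement_mem_center _ _),
    h.commute_congr rfl hl]
  exact ((Commute.refl c).zpow_zpow k l).pow_right m

/-- The characters `xᵢ mod d` and `xⱼ mod d` with `d = gcd (nᵢ, nⱼ)` take the lifts of the `i`-th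
and `j`-th generator to the identity matrix. -/
theorem IsSchurCover.exists_gcd_dvd_orderOf_commutatorElement (h : IsSchurCover π) {ι : Type*}
    {n : ι → ℕ} (φ : A ≃* ((i : ι) → Multiplicative (ZMod (n i)))) {i j : ι} (hij : i ≠ j) :
    ∃ a b : E, (n i).gcd (n j) ∣ orderOf ⁅a, b⁆ := by
  classical
  let coord (l : ι) (hl : (n i).gcd (n j) ∣ n l) : A →* Multiplicative (ZMod ((n i).gcd (n j))) :=
    (AddMonoidHom.toMultiplicative (ZMod.castHom hl (ZMod ((n i).gcd (n j)))).toAddMonoidHom).comp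
      ((Pi.evalMonoidHom _ l).comp φ.toMonoidHom)
  let gen (l : ι) : A := φ.symm (Pi.mulSingle l (.ofAdd 1))
  have hcoord_self : ∀ l hl, (coord l hl (gen l)).toAdd = 1 := fun l hl => by
    change ZMod.castHom hl _ (φ (gen l) l).toAdd = 1
    simp [gen, ZMod.cast_one hl]
  have hcoord_ne : ∀ l hl k, l ≠ k → (coord l hl (gen k)).toAdd = 0 := fun l hl k hlk => by
    change ZMod.castHom hl _ (φ (gen k) l).toAdd = 0
    simp [gen, Pi.mulSingle_eq_of_ne hlk]
  obtain ⟨a, ha⟩ := h.isStemExtension.surjective (gen i)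
  obtain ⟨b, hb⟩ := h.isStemExtension.surjective (gen j)
  refine ⟨a, b, h.dvd_orderOf_commutatorElement ((coord i (Nat.gcd_dvd_left _ _)).comp π)
    ((coord j (Nat.gcd_dvd_right _ _)).comp π) (Commute.all _ _) ?_⟩
  simp only [MonoidHom.comp_apply, ha, hb, hcoord_self, hcoord_ne i _ j hij,
    hcoord_ne j _ i hij.symm, mul_one, mul_zero, sub_zero, isUnit_one]

theorem IsSchurCover.gcd_dvd_of_forall_pow_mem_center (h : IsSchurCover π) {ι : Type*} {n : ι → ℕ}
    (φ : A ≃* ((i : ι) → Multiplicative (ZMod (n i)))) {m : ℕ}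
    (hm : ∀ a : E, a ^ m ∈ Subgroup.center E) {i j : ι} (hij : i ≠ j) :
    (n i).gcd (n j) ∣ m := by
  obtain ⟨a, b, hab⟩ := h.exists_gcd_dvd_orderOf_commutatorElement φ hij
  exact hab.trans (orderOf_commutatorElement_dvd
    (Subgroup.mem_center_iff.1 (h.isCentralExtension.commutatorElement_mem_center a b) a)
    (Subgroup.mem_center_iff.1 (hm a) b).symm)

theorem IsSchurCover.forall_pow_mem_center_tfae (h : IsSchurCover π) {ι : Type*} [Finite ι]
    {n : ι → ℕ} [∀ i, NeZero (n i)] (φ : A ≃* ((i : ι) → Multiplicative (ZMod (n i)))) (m : ℕ) :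
    List.TFAE [∀ a : E, a ^ m ∈ Subgroup.center E, Pairwise fun i j => (n i).gcd (n j) ∣ m,
      IsCyclic (powMonoidHom m : A →* A).range] := by
  tfae_have 1 → 2 := fun hm i j hij => h.gcd_dvd_of_forall_pow_mem_center φ hm hij
  tfae_have 2 → 3 := fun hm => isCyclic_range_pow_of_mulEquiv φ (isCyclic_range_pow_pi_zmod hm)
  tfae_have 3 → 1 := h.isCentralExtension.pow_mem_center_of_isCyclic_range_pow
  tfae_finish

theorem IsSchurCover.forall_pow_mem_center_iff_isCyclic_range_pow (h : IsSchurCover π) (m : ℕ) :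
    (∀ a : E, a ^ m ∈ Subgroup.center E) ↔ IsCyclic (powMonoidHom m : A →* A).range := by
  have := h.finite
  have : Finite A := .of_surjective π h.isStemExtension.surjective
  obtain ⟨ι, _, n, hn, ⟨φ⟩⟩ := CommGroup.equiv_prod_multiplicative_zmod_of_finite A
  have : ∀ i, NeZero (n i) := fun i => ⟨(one_pos.trans (hn i)).ne'⟩
  exact (h.forall_pow_mem_center_tfae φ m).out 0 2

end CentralExponent

section CyclicTimesElementary

theorem IsElementaryAbelian.pow_eq_one {p : ℕ} {K : Type*} [CommGroup K]
    (hK : IsElementaryAbelian p K) (x : K) : x ^ p = 1 := by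
  by_cases hx : x = 1
  · rw [hx, one_pow]
  · rw [← hK x hx, pow_orderOf_eq_one]

theorem isElementaryAbelian_of_forall_pow_eq_one {p : ℕ} (hp : p.Prime) {K : Type*} [CommGroup K]
    (hK : ∀ x : K, x ^ p = 1) : IsElementaryAbelian p K := by
  have : Fact p.Prime := ⟨hp⟩
  exact fun x hx => orderOf_eq_prime (hK x) hx

theorem complementedLattice_subgroup_of_forall_pow_eq_one {p : ℕ} (hp : p.Prime) {T : Type*}
    [CommGroup T] (hT : ∀ x : T, x ^ p = 1) : ComplementedLattice (Subgroup T) := by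
  have : Fact p.Prime := ⟨hp⟩
  have : Module (ZMod p) (Additive T) := AddCommGroup.zmodModule hT
  have e : Subgroup T ≃o Submodule (ZMod p) (Additive T) :=
    (Subgroup.toAddSubgroup (G := T)).trans (AddSubgroup.toZModSubmodule p)
  exact e.complementedLattice_iff.2 inferInstance

variable {A : Type*} [CommGroup A]

/-- The elementary abelian factor is a complement of `⟨g⟩ ∩ A[p]` in the `p`-torsion `A[p]`; as
`A ^ p = ⟨g ^ p⟩`, the subgroups `⟨g⟩` and `A[p]` generate `A`. -/
theorem exists_isCompl_of_isCyclic_range_pow {p : ℕ} (hp : p.Prime)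
    (hA : IsCyclic (powMonoidHom p : A →* A).range) :
    ∃ C K : Subgroup A, IsCompl C K ∧ IsCyclic C ∧ ∀ x ∈ K, x ^ p = 1 := by
  obtain ⟨g, hg⟩ := isCyclic_range_pow_iff.1 hA
  let C := Subgroup.zpowers g
  let T := (powMonoidHom p : A →* A).ker
  have hCT : C ⊔ T = ⊤ := by
    refine eq_top_iff.2 fun x _ => ?_
    obtain ⟨k, hk : (g ^ p) ^ k = x ^ p⟩ := hg x
    rw [← mul_inv_cancel_left (g ^ k) x]
    refine Subgroup.mul_mem_sup ⟨k, rfl⟩ ?_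
    rw [MonoidHom.mem_ker, powMonoidHom_apply, mul_pow, inv_pow, ← hk, inv_mul_eq_one]
    simpa only [zpow_natCast] using zpow_comm g k p
  have := complementedLattice_subgroup_of_forall_pow_eq_one hp (T := T)
    fun x => Subtype.ext x.2
  obtain ⟨K, hK⟩ := exists_isCompl (C.subgroupOf T)
  refine ⟨C, K.map T.subtype, ⟨?_, ?_⟩, inferInstance, ?_⟩
  · refine Subgroup.disjoint_def.2 ?_
    rintro _ hxC ⟨x, hxK, rfl⟩
    exact congrArg T.subtype (Subgroup.disjoint_def.1 hK.disjoint hxC hxK)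
  · rw [codisjoint_iff, eq_top_iff, ← hCT]
    refine sup_le le_sup_left ?_
    have hT := congrArg (Subgroup.map T.subtype) hK.sup_eq_top
    rw [Subgroup.map_sup, Subgroup.subgroupOf_map_subtype, ← MonoidHom.range_eq_map,
      Subgroup.range_subtype] at hT
    nth_rw 1 [← hT]
    exact sup_le_sup_right inf_le_left _
  · rintro _ ⟨x, -, rfl⟩
    exact x.2

theorem nonempty_mulEquiv_prod_of_isCompl {C K : Subgroup A} (h : IsCompl C K) :
    Nonempty (A ≃* C × K) := by
  refine ⟨(MulEquiv.ofBijective (C.subtype.coprod K.subtype) ⟨?_, ?_⟩).symm⟩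
  · refine (injective_iff_map_eq_one _).2 fun x hx => ?_
    have hxK : (x.1 : A) ∈ K := by
      rw [eq_inv_of_mul_eq_one_left (show (x.1 * x.2 : A) = 1 from hx)]
      exact inv_mem x.2.2
    have hx1 : (x.1 : A) = 1 := Subgroup.disjoint_def.1 h.disjoint x.1.2 hxK
    refine Prod.ext (Subtype.ext hx1) (Subtype.ext ?_)
    simpa [hx1] using hx
  · intro x
    obtain ⟨y, hy, z, hz, rfl⟩ := Subgroup.mem_sup.1 (h.sup_eq_top ▸ Subgroup.mem_top x)
    exact ⟨(⟨y, hy⟩, ⟨z, hz⟩), rfl⟩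

theorem isCyclic_range_pow_iff_exists_mulEquiv_prod [Finite A] {p : ℕ} (hp : p.Prime) :
    IsCyclic (powMonoidHom p : A →* A).range ↔
      ∃ (C K : Type) (_ : CommGroup C) (_ : CommGroup K),
        IsCyclic C ∧ IsElementaryAbelian p K ∧ Nonempty (A ≃* C × K) := by
  constructor
  · intro hA
    obtain ⟨C, K, hCK, hC, hK⟩ := exists_isCompl_of_isCyclic_range_pow hp hA
    obtain ⟨φ⟩ := nonempty_mulEquiv_prod_of_isCompl hCK
    let eC : Shrink.{0} C ≃* C := Shrink.mulEquiv
    let eK : Shrink.{0} K ≃* K := Shrink.mulEquiv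
    refine ⟨Shrink.{0} C, Shrink.{0} K, inferInstance, inferInstance, eC.isCyclic.2 hC, ?_,
      ⟨φ.trans (eC.symm.prodCongr eK.symm)⟩⟩
    refine isElementaryAbelian_of_forall_pow_eq_one hp fun x => eK.injective ?_
    rw [map_pow, map_one]
    exact Subtype.ext (hK _ (eK x).2)
  · rintro ⟨C, K, _, _, hC, hK, ⟨φ⟩⟩
    refine isCyclic_range_pow_of_mulEquiv φ (isCyclic_range_pow_iff.2 ?_)
    obtain ⟨c, hc⟩ := hC.exists_generator
    refine ⟨(c, 1), fun x => ?_⟩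
    obtain ⟨k, hk : c ^ k = x.1⟩ := hc x.1
    refine ⟨k, Prod.ext ?_ ?_⟩
    · simpa only [Prod.pow_mk, Prod.pow_fst, zpow_natCast, hk] using zpow_comm c p k
    · simp [hK.pow_eq_one]

end CyclicTimesElementary

section PrimePowerType

variable {A : Type*} [CommGroup A]

theorem exists_eq_prime_pow_of_isPGroup {p : ℕ} (hp : p.Prime) (hA : IsPGroup p A)
    {ι : Type*} {n : ι → ℕ} (φ : A ≃* ((i : ι) → Multiplicative (ZMod (n i)))) (i : ι) :
    ∃ r, n i = p ^ r := by
  classical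
  obtain ⟨k, hk⟩ := hA (φ.symm (Pi.mulSingle i (.ofAdd 1)))
  rw [← map_pow, MulEquiv.map_eq_one_iff] at hk
  have hzero : ((p ^ k : ℕ) : ZMod (n i)) = 0 := by
    simpa using congrArg Multiplicative.toAdd (congrFun hk i)
  obtain ⟨r, -, hr⟩ := (Nat.dvd_prime_pow hp).1 ((ZMod.natCast_eq_zero_iff _ _).1 hzero)
  exact ⟨r, hr⟩

theorem exists_antitone_comp_equiv {ι α : Type*} [Fintype ι] [LinearOrder α] (s : ι → α) :
    ∃ σ : Fin (Fintype.card ι) ≃ ι, Antitone (s ∘ σ) := by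
  let σ := (Fintype.equivFin ι).symm
  exact ⟨(Tuple.sort (OrderDual.toDual ∘ s ∘ σ)).trans σ,
    Tuple.monotone_sort (OrderDual.toDual ∘ s ∘ σ)⟩

theorem exists_hasPType [Finite A] {p : ℕ} (hp : p.Prime) (hA : IsPGroup p A) :
    ∃ (k : ℕ) (r : Fin k → ℕ), HasPType p A r := by
  obtain ⟨ι, _, n, hn, ⟨φ⟩⟩ := CommGroup.equiv_prod_multiplicative_zmod_of_finite A
  choose s hs using exists_eq_prime_pow_of_isPGroup hp hA φ
  obtain rfl : n = fun i => p ^ s i := funext hs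
  obtain ⟨σ, hσ⟩ := exists_antitone_comp_equiv s
  refine ⟨Fintype.card ι, s ∘ σ, hσ, fun i => ?_, ?_⟩
  · refine Nat.one_le_iff_ne_zero.2 fun hzero => (hn (σ i)).ne' ?_
    exact (congrArg (p ^ ·) hzero).trans (pow_zero p)
  · exact ⟨φ.trans ⟨Equiv.piCongrLeft' (fun i => Multiplicative (ZMod (p ^ s i))) σ.symm,
      fun _ _ => rfl⟩⟩

theorem HasPType.two_le_of_not_isCyclic {p k : ℕ} {r : Fin k → ℕ} (h : HasPType p A r)
    (hA : ¬ IsCyclic A) : 2 ≤ k := by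
  obtain ⟨φ⟩ := h.iso
  by_contra! hk
  refine hA (φ.isCyclic.2 ?_)
  interval_cases k
  · infer_instance
  · exact (MulEquiv.piUnique fun i => Multiplicative (ZMod (p ^ r i))).isCyclic.2 inferInstance

theorem HasPType.exists_prime_gcd_dvd_iff {p k : ℕ} (hp : p.Prime) (hk : 2 ≤ k) {r : Fin k → ℕ}
    (h : HasPType p A r) :
    (∃ q : ℕ, q.Prime ∧ Pairwise fun i j => (p ^ r i).gcd (p ^ r j) ∣ q) ↔ r ⟨1, hk⟩ = 1 := by
  constructor
  · rintro ⟨q, hq, hgcd⟩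
    have hle : r ⟨1, hk⟩ ≤ r ⟨0, by lia⟩ := h.antitone (Fin.mk_le_mk.2 zero_le_one)
    have hdvd : p ^ r ⟨1, hk⟩ ∣ q :=
      (Nat.dvd_gcd (pow_dvd_pow p hle) dvd_rfl).trans (hgcd (by simp))
    obtain rfl : p = q := (Nat.prime_dvd_prime_iff_eq hp hq).1
      ((dvd_pow_self p (Nat.one_le_iff_ne_zero.1 (h.pos _))).trans hdvd)
    refine le_antisymm ((Nat.pow_dvd_pow_iff_le_right hp.one_lt).1 ?_) (h.pos _)
    rwa [pow_one]
  · intro hr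
    have hdvd : ∀ i : Fin k, i ≠ ⟨0, by lia⟩ → p ^ r i ∣ p := fun i hi => by
      have hle : r i ≤ 1 := hr ▸ h.antitone (Fin.mk_le_of_le_val
        (Nat.one_le_iff_ne_zero.2 fun hzero => hi (Fin.ext hzero)))
      simpa using pow_dvd_pow p hle
    refine ⟨p, hp, fun i j hij => ?_⟩
    by_cases hi : i = ⟨0, by lia⟩
    · exact (Nat.gcd_dvd_right _ _).trans (hdvd j (hi ▸ hij.symm))
    · exact (Nat.gcd_dvd_left _ _).trans (hdvd i hi)

end PrimePowerType

section MainResults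

variable {E A : Type*} [Group E] [CommGroup A] {π : E →* A}

theorem IsSchurCover.not_connected_iff_of_hasPType (h : IsSchurCover π) {p k : ℕ} (hp : p.Prime)
    (hk : 2 ≤ k) {r : Fin k → ℕ} (hr : HasPType p A r) :
    ¬ (reducedGraph (deepCommutingGraph π)).Connected ↔ r ⟨1, hk⟩ = 1 := by
  obtain ⟨φ⟩ := hr.iso
  have : ∀ i, NeZero (p ^ r i) := fun i => ⟨pow_ne_zero _ hp.ne_zero⟩
  rw [h.not_connected_iff_exists_prime, ← hr.exists_prime_gcd_dvd_iff hp hk]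
  exact exists_congr fun q => and_congr_right fun _ => (h.forall_pow_mem_center_tfae φ q).out 0 1

theorem IsSchurCover.not_connected_iff_exists_mulEquiv_prod (h : IsSchurCover π) :
    ¬ (reducedGraph (deepCommutingGraph π)).Connected ↔
      ∃ (p : ℕ) (C K : Type) (_ : CommGroup C) (_ : CommGroup K),
        p.Prime ∧ IsCyclic C ∧ IsElementaryAbelian p K ∧ Nonempty (A ≃* C × K) := by
  have := h.finite
  have : Finite A := .of_surjective π h.isStemExtension.surjective
  rw [h.not_connected_iff_exists_prime]
  refine exists_congr fun p => ?_
  simp only [exists_and_left]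
  refine and_congr_right fun hp => ?_
  rw [h.forall_pow_mem_center_iff_isCyclic_range_pow,
    isCyclic_range_pow_iff_exists_mulEquiv_prod hp]
  simp only [exists_and_left]

end MainResults

theorem mainTheorem8 :
    -- finite non-cyclic abelian `p`-groups
    (∀ (p : ℕ) (G : Type*) [CommGroup G] [Finite G], p.Prime → IsPGroup p G → ¬ IsCyclic G →
      (∃ (k : ℕ) (r : Fin k → ℕ), 2 ≤ k ∧ HasPType p G r) ∧
      (∃ (E : Type) (_ : Group E) (π : E →* G), IsSchurCover π) ∧
      ∀ (k : ℕ) (hk : 2 ≤ k) (r : Fin k → ℕ), HasPType p G r →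
        ∀ (E : Type*) [Group E] (π : E →* G), IsSchurCover π →
          (¬ (reducedGraph (deepCommutingGraph π)).Connected ↔ r ⟨1, hk⟩ = 1)) ∧
    -- finite non-cyclic abelian groups
    (∀ (A : Type*) [CommGroup A] [Finite A], ¬ IsCyclic A →
      (∃ (E : Type) (_ : Group E) (π : E →* A), IsSchurCover π) ∧
      ∀ (E : Type*) [Group E] (π : E →* A), IsSchurCover π →
        (¬ (reducedGraph (deepCommutingGraph π)).Connected ↔
          ∃ (p : ℕ) (C K : Type) (_ : CommGroup C) (_ : CommGroup K),
            p.Prime ∧ IsCyclic C ∧ IsElementaryAbelian p K ∧ Nonempty (A ≃* C × K))) := by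
  refine ⟨fun p G _ _ hp hpG hG => ⟨?_, exists_isSchurCover G, ?_⟩,
    fun A _ _ _ => ⟨exists_isSchurCover A, ?_⟩⟩
  · obtain ⟨k, r, hr⟩ := exists_hasPType hp hpG
    exact ⟨k, r, hr.two_le_of_not_isCyclic hG, hr⟩
  · exact fun k hk r hr E _ π h => h.not_connected_iff_of_hasPType hp hk hr
  · exact fun E _ π h => h.not_connected_iff_exists_mulEquiv_prod
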